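/- Let $k$ be a field, let $\overline{k}$ be an algebraic closure of $k$, and let $q\colon G\to H$ be a flat homomorphism of $k$-group schemes, where $G$ and $H$ are locally of finite type over $k$. (i) If $q$ is surjective, then $q$ is an fppf morphism, i.e., $q$ is faithfully flat (flat and surjective) and locally of finite presentation. (ii) If the induced map $q(\overline{k})\colon G(\overline{k})\to H(\overline{k})$ on $\overline{k}$-valued points (over $k$) is surjective, then $q$ is surjective as a morphism of schemes. -/

import Mathlib

open CategoryTheory AlgebraicGeometry

universe u

namespace FlatGroup

/-- A morphism of schemes is faithfully flat if it is flat and surjective. -/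
structure IsFaithfullyFlat {X Y : Scheme.{u}} (f : X ⟶ Y) : Prop where
  flat : Flat f
  surjective : Surjective f

/-- A morphism of schemes is fppf if it is faithfully flat and locally of finite presentation. -/
structure IsFppf {X Y : Scheme.{u}} (f : X ⟶ Y) : Prop where
  faithfullyFlat : IsFaithfullyFlat f
  locallyOfFinitePresentation : LocallyOfFinitePresentation f

/-- The set `X(K)` of `K`-valued points of a `k`-scheme `X`, for a field extension `K` of `k`:
the morphisms of `k`-schemes from `Spec K` to `X`. -/
abbrev Points {k : Type u} [Field k] (X : Over (Spec (.of k))) (K : Type u) [Field K]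
    [Algebra k K] : Type u :=
  Over.mk (Spec.map (CommRingCat.ofHom (algebraMap k K))) ⟶ X

/-- The map `q(K) : X(K) → Y(K)` induced by a morphism `q : X ⟶ Y` of `k`-schemes. -/
noncomputable def pointsMap {k : Type u} [Field k] {X Y : Over (Spec (.of k))} (q : X ⟶ Y) (K : Type u)
    [Field K] [Algebra k K] : Points X K → Points Y K :=
  fun x ↦ x ≫ q

end FlatGroup

namespace FlatGroup

/-! Since `H` is locally noetherian, `q` is locally of finite presentation, which gives (i). Being
flat as well, `q` is open, so the complement of its range is closed. If nonempty, it contains a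
closed point because `H` is Jacobson; by the Nullstellensatz that point underlies a `kbar`-point,
whose lift to `G` gives a contradiction. -/

/-- Every closed point of a scheme locally of finite type over a field `k` is the image of a
point with values in any algebraically closed extension of `k`. -/
theorem exists_point_apply_eq {k : Type u} [Field k] (K : Type u) [Field K] [Algebra k K]
    [IsAlgClosed K] (X : Over (Spec (.of k))) [LocallyOfFiniteType X.hom] (x : X.left)
    (hx : IsClosed {x}) : ∃ p : Points X K, ∀ s : Spec (.of K), p.left s = x := by
  have : JacobsonSpace X.left := LocallyOfFiniteType.jacobsonSpace (Y := Spec (.of k)) X.hom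
  let f : Spec (X.left.residueField x) ⟶ Spec (.of k) := X.left.fromSpecResidueField x ≫ X.hom
  have hf : IsFinite f := by
    rw [isClosed_singleton_iff_isClosedImmersion] at hx
    -- Zariski's lemma: a residue field of finite type over `k` is finite over `k`.
    rw [isFinite_iff_locallyOfFiniteType_of_jacobsonSpace]
    infer_instance
  let φ : CommRingCat.of k ⟶ X.left.residueField x := Spec.preimage f
  have hφ : φ.hom.IsIntegral := by
    rw [← IsIntegralHom.SpecMap_iff, Spec.map_preimage]
    infer_instance
  let : Algebra k (X.left.residueField x) := φ.hom.toAlgebra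
  have : Algebra.IsIntegral k (X.left.residueField x) := ⟨hφ⟩
  let l : X.left.residueField x →ₐ[k] K := IsAlgClosed.lift
  obtain ⟨ψ, hψ⟩ : ∃ ψ : X.left.residueField x ⟶ .of K,
      φ ≫ ψ = CommRingCat.ofHom (algebraMap k K) :=
    ⟨CommRingCat.ofHom l.toRingHom, by ext a; exact l.commutes a⟩
  refine ⟨Over.homMk (Spec.map ψ ≫ X.left.fromSpecResidueField x) ?_,
    fun s ↦ X.left.fromSpecResidueField_apply x (Spec.map ψ s)⟩
  change (Spec.map ψ ≫ X.left.fromSpecResidueField x) ≫ X.hom = Spec.map _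
  rw [← hψ, Spec.map_comp, Spec.map_preimage, Category.assoc]

/-- A morphism between schemes locally of finite type over a field is locally of finite
presentation. -/
theorem locallyOfFinitePresentation_left {k : Type u} [Field k] {X Y : Over (Spec (.of k))}
    [LocallyOfFiniteType X.hom] [LocallyOfFiniteType Y.hom] (q : X ⟶ Y) :
    LocallyOfFinitePresentation q.left := by
  have : IsLocallyNoetherian Y.left := LocallyOfFiniteType.isLocallyNoetherian Y.hom
  rw [LocallyOfFinitePresentation.iff_locallyOfFiniteType]
  have : LocallyOfFiniteType (q.left ≫ Y.hom) := by rwa [Over.w q]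
  exact locallyOfFiniteType_of_comp q.left Y.hom

/-- A flat morphism between schemes locally of finite type over a field `k` is surjective if it is
surjective on points with values in an algebraically closed extension of `k`. -/
theorem surjective_left_of_surjective_pointsMap {k : Type u} [Field k] (K : Type u) [Field K]
    [Algebra k K] [IsAlgClosed K] {X Y : Over (Spec (.of k))} [LocallyOfFiniteType X.hom]
    [LocallyOfFiniteType Y.hom] (q : X ⟶ Y) [Flat q.left]
    (hq : Function.Surjective (pointsMap q K)) : Surjective q.left := by
  have := locallyOfFinitePresentation_left q
  have : JacobsonSpace Y.left := LocallyOfFiniteType.jacobsonSpace (Y := Spec (.of k)) Y.hom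
  refine ⟨Set.range_eq_univ.mp ?_⟩
  by_contra h
  -- Openness of `q.left` comes from flatness and local finite presentation.
  obtain ⟨y, hy, hy'⟩ := nonempty_inter_closedPoints (Set.nonempty_compl.mpr h)
    q.left.isOpenMap.isOpen_range.isClosed_compl.isLocallyClosed
  obtain ⟨p, hp⟩ := exists_point_apply_eq K Y y hy'
  obtain ⟨r, rfl⟩ := hq p
  let s : Spec (.of K) := IsLocalRing.closedPoint K
  exact hy ⟨r.left s, by simpa [pointsMap] using hp s⟩

end FlatGroup

theorem mainTheorem12 (k : Type u) [Field k] (kbar : Type u) [Field kbar] [Algebra k kbar]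
    [IsAlgClosure k kbar] (G H : Over (Spec (.of k))) [GrpObj G] [GrpObj H]
    (hG : LocallyOfFiniteType G.hom) (hH : LocallyOfFiniteType H.hom)
    (q : G ⟶ H) [IsMonHom q] (hq : Flat q.left) :
    (Surjective q.left → FlatGroup.IsFppf q.left) ∧
      (Function.Surjective (FlatGroup.pointsMap q kbar) → Surjective q.left) := by
  have : IsAlgClosed kbar := IsAlgClosure.isAlgClosed k
  exact ⟨fun h ↦ ⟨⟨hq, h⟩, FlatGroup.locallyOfFinitePresentation_left q⟩,
    FlatGroup.surjective_left_of_surjective_pointsMap kbar q⟩
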